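/- Let $R$ be an artinian ring (only the descending chain condition on right ideals is needed), let $\mathrm{Mod}\,R$ be the category of right $R$-modules, and let $\mathcal{S}$ be a full subcategory of $\mathrm{Mod}\,R$ that contains the right module $R_R$ and is closed under arbitrary direct sums and under subobjects (that is, if $Y \to X$ is a monomorphism of $R$-modules and $X \in \mathcal{S}$, then $Y \in \mathcal{S}$; in particular $\mathcal{S}$ is closed under isomorphism). Call a module indecomposable if it is nonzero and is not the direct sum of two nonzero modules. If there are, up to isomorphism, only finitely many indecomposable modules of finite length in $\mathcal{S}$, then every object $X$ of $\mathcal{S}$ is an (internal) direct sum $X=\bigoplus_{i\in I} N_i$ of a family of finitely generated indecomposable submodules $N_i\subseteq X$. In particular, every indecomposable module in $\mathcal{S}$ has finite length. -/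

import Mathlib

open CategoryTheory

universe u

/-! Take a finite family `M` of pairwise non-isomorphic indecomposables of finite length that
represents all those in `S`. Finitely generated submodules of any `X` in `S` are finite sums of
members. By Harada–Sai, long compositions of non-isomorphisms inside `M` vanish, so the radical is
nilpotent and the groups Hom(`M i`, `X`) obey Nakayama in both forms (`eq_bot_of_le_radicalMul`,
`eq_top_of_sup_radicalMul_eq_top`).

Bases of Hom(`M i`, `X`) modulo radical maps assemble to a map `g` from a direct sum of members to
`X` (`exists_directSum_map_modulo_radical`). Nakayama shows that every map `M i → X` lifts through
`g`. If `g ∘ f = 0`, independence of the bases gives `f = y ∘ r` with `r` radical and `y` defined on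
a finite sum. The image of `g ∘ y` is finitely generated, so its inclusion lifts through `g`;
subtracting the lift from `y` gives `g ∘ y = 0` without changing `y ∘ r`. Thus the maps killed by
`g` lie in their own radical multiple and vanish. Since the regular module is a finite sum of
members, `g` is bijective (`exists_linearEquiv_directSum`). -/

/-- A module is indecomposable if it is nonzero and has no proper direct summands. -/
def IsIndecomposableModule (A M : Type*) [Ring A] [AddCommGroup M] [Module A M] : Prop :=
  Nontrivial M ∧ ∀ p q : Submodule A M, IsCompl p q → p = ⊥ ∨ q = ⊥

theorem LinearEquiv.isIndecomposableModule {A M N : Type*} [Ring A] [AddCommGroup M] [Module A M]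
    [AddCommGroup N] [Module A N] (e : M ≃ₗ[A] N) (h : IsIndecomposableModule A M) :
    IsIndecomposableModule A N := by
  obtain ⟨h1, h2⟩ := h
  refine ⟨e.symm.toEquiv.nontrivial, fun p q hpq => ?_⟩
  have := h2 _ _ (hpq.map (Submodule.orderIsoMapComap e.symm))
  simpa using this

theorem indecomposable_iff_isIndecomposableModule {A : Type u} [Ring A] (X : ModuleCat.{u} A) :
    Indecomposable X ↔ IsIndecomposableModule A X := by
  constructor
  · rintro ⟨h0, h⟩
    refine ⟨?_, fun p q hpq => ?_⟩
    · rw [ModuleCat.isZero_iff_subsingleton] at h0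
      exact not_subsingleton_iff_nontrivial.mp h0
    · have e : X ≅ ModuleCat.of A p ⊞ ModuleCat.of A q :=
        (Submodule.prodEquivOfIsCompl p q hpq).symm.toModuleIso ≪≫
          (ModuleCat.biprodIsoProd (ModuleCat.of A p) (ModuleCat.of A q)).symm
      refine (h _ _ e).imp (fun hz => ?_) (fun hz => ?_)
      all_goals
        rw [ModuleCat.isZero_iff_subsingleton] at hz
        exact (Submodule.subsingleton_iff_eq_bot).mp hz
  · rintro ⟨h0, h⟩
    refine ⟨?_, fun Y Z e => ?_⟩
    · rw [ModuleCat.isZero_iff_subsingleton]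
      exact not_subsingleton_iff_nontrivial.mpr h0
    · let e' : (Y × Z) ≃ₗ[A] X := (e ≪≫ ModuleCat.biprodIsoProd Y Z).symm.toLinearEquiv
      have hc := (LinearMap.isCompl_range_inl_inr (R := A) (M := Y) (M₂ := Z)).map
        (Submodule.orderIsoMapComap e')
      have := h _ _ hc
      simp only [ModuleCat.isZero_iff_subsingleton]
      simp only [map_eq_bot_iff, LinearMap.range_eq_bot] at this
      refine this.imp (fun hz => ?_) (fun hz => ?_)
      · exact ⟨fun a b => LinearMap.inl_injective (by rw [hz]; rfl)⟩
      · exact ⟨fun a b => LinearMap.inr_injective (by rw [hz]; rfl)⟩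

/-! ### Splittings forced by a composite -/

section Complements

variable {A : Type*} [Ring A] {L M N : Type*} [AddCommGroup L] [Module A L]
  [AddCommGroup M] [Module A M] [AddCommGroup N] [Module A N]

theorem isCompl_range_ker_of_range_comp_eq (f : L →ₗ[A] M) (g : M →ₗ[A] N)
    (hd : Disjoint (LinearMap.range f) (LinearMap.ker g))
    (hr : LinearMap.range g ≤ LinearMap.range (g ∘ₗ f)) :
    IsCompl (LinearMap.range f) (LinearMap.ker g) := by
  refine ⟨hd, codisjoint_iff_le_sup.mpr fun m _ => ?_⟩
  obtain ⟨l, hl⟩ := hr ⟨m, rfl⟩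
  refine Submodule.mem_sup.mpr ⟨f l, ⟨l, rfl⟩, m - f l, ?_, by abel⟩
  simpa [sub_eq_zero] using hl.symm

/-- The image of `f` and the kernel of `g` are complementary, and the image is nonzero because `L`
is. This makes non-isomorphisms stable under composition. -/
theorem IsIndecomposableModule.bijective_of_bijective_comp [Nontrivial L]
    (hM : IsIndecomposableModule A M) (f : L →ₗ[A] M) (g : M →ₗ[A] N)
    (h : Function.Bijective (g ∘ₗ f)) : Function.Bijective f ∧ Function.Bijective g := by
  have hc : IsCompl (LinearMap.range f) (LinearMap.ker g) := by
    refine isCompl_range_ker_of_range_comp_eq f g ?_ ?_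
    · rw [Submodule.disjoint_def]
      rintro _ ⟨l, rfl⟩ hl
      have : l = 0 := h.1 (by simpa using hl)
      simp [this]
    · rw [LinearMap.range_eq_top.mpr h.2]
      exact le_top
  have hf : Function.Injective f := Function.Injective.of_comp h.1
  have hk : LinearMap.ker g = ⊥ := by
    refine (hM.2 _ _ hc).resolve_left fun hb => ?_
    obtain ⟨l, hl⟩ := exists_ne (0 : L)
    rw [LinearMap.range_eq_bot] at hb
    exact hl (hf (by simp [hb]))
  have ht := hc.sup_eq_top
  rw [hk, sup_bot_eq, LinearMap.range_eq_top] at ht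
  exact ⟨⟨hf, ht⟩, LinearMap.ker_eq_bot.mp hk, Function.Surjective.of_comp h.2⟩

end Complements

/-! ### The Harada–Sai lemma -/

section HaradaSai

variable {A : Type*} [Ring A] {ι : Type*} (M : ι → Type u) [∀ i, AddCommGroup (M i)]
  [∀ i, Module A (M i)]

/-- Compositions of `n` maps of the family `M` none of which is bijective. -/
inductive IsRadicalPath : ℕ → ∀ i j : ι, (M i →ₗ[A] M j) → Prop
  | id (i : ι) : IsRadicalPath 0 i i LinearMap.id
  | comp {n : ℕ} {i j k : ι} (f : M i →ₗ[A] M j) (g : M j →ₗ[A] M k)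
      (hf : ¬ Function.Bijective f) (hg : IsRadicalPath n j k g) :
      IsRadicalPath (n + 1) i k (g ∘ₗ f)

variable {M}

theorem IsRadicalPath.exists_of_add {m n : ℕ} {i k : ι} {f : M i →ₗ[A] M k}
    (h : IsRadicalPath M (m + n) i k f) :
    ∃ j, ∃ g : M i →ₗ[A] M j, ∃ g' : M j →ₗ[A] M k,
      IsRadicalPath M m i j g ∧ IsRadicalPath M n j k g' ∧ f = g' ∘ₗ g := by
  induction m generalizing i with
  | zero => exact ⟨i, LinearMap.id, f, .id i, by simpa using h, rfl⟩
  | succ m ih =>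
    rw [show m + 1 + n = (m + n) + 1 by omega] at h
    cases h with
    | comp a b ha hb =>
      obtain ⟨j, g, g', hg, hg', rfl⟩ := ih hb
      exact ⟨j, g ∘ₗ a, g', .comp _ _ ha hg, hg', rfl⟩

/-- A nonzero kernel of `g` on the image of `f` would strictly shorten that image, its length being
finite. -/
theorem disjoint_range_ker_of_length_le {L M N : Type*} [AddCommGroup L] [Module A L]
    [AddCommGroup M] [Module A M] [AddCommGroup N] [Module A N]
    [IsArtinian A M] [IsNoetherian A M] (f : L →ₗ[A] M) (g : M →ₗ[A] N)
    (h : Module.length A (LinearMap.range f) ≤ Module.length A (LinearMap.range (g ∘ₗ f))) :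
    Disjoint (LinearMap.range f) (LinearMap.ker g) := by
  by_contra hd
  let p := LinearMap.range f
  let g' : p →ₗ[A] N := g ∘ₗ p.subtype
  have hk : LinearMap.ker g' ≠ ⊥ := by
    intro hk
    apply hd
    rw [Submodule.disjoint_def]
    intro x hx hx'
    have : (⟨x, hx⟩ : p) ∈ LinearMap.ker g' := hx'
    rw [hk] at this
    simpa using congrArg Subtype.val ((Submodule.mem_bot A).mp this)
  have h1 := Submodule.length_quotient_lt (LinearMap.ker g') hk
  rw [(LinearMap.quotKerEquivRange g').length_eq] at h1
  have h2 : LinearMap.range g' = LinearMap.range (g ∘ₗ f) := by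
    rw [LinearMap.range_comp, LinearMap.range_comp, Submodule.range_subtype]
  rw [h2] at h1
  exact absurd h (not_le.mpr h1)

/-- The Harada–Sai bound on the length of the images of compositions of non-isomorphisms. -/
theorem IsRadicalPath.eq_zero_or_length_le [∀ i, IsArtinian A (M i)] [∀ i, IsNoetherian A (M i)]
    (hM : ∀ i, IsIndecomposableModule A (M i)) {b : ℕ} (hb : ∀ i, Module.length A (M i) ≤ b)
    (m : ℕ) {i j : ι} {f : M i →ₗ[A] M j} (hf : IsRadicalPath M (2 ^ m - 1) i j f) :
    f = 0 ∨ Module.length A (LinearMap.range f) + m ≤ b := by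
  induction m generalizing i j with
  | zero =>
    right
    simpa using (Module.length_le_of_injective (LinearMap.range f).subtype
      Subtype.val_injective).trans (hb j)
  | succ m ih =>
    have hpos : 0 < 2 ^ m := by positivity
    -- Split the path into two of length `2 ^ m - 1` around a single non-isomorphism `r`.
    rw [show 2 ^ (m + 1) - 1 = (2 ^ m - 1) + ((2 ^ m - 1) + 1) by rw [pow_succ]; omega] at hf
    obtain ⟨k, p, q, hp, hq, rfl⟩ := hf.exists_of_add
    cases hq with
    | @comp _ _ l _ r s hr hs =>
    rw [or_iff_not_imp_left]
    intro hne
    have hp0 : p ≠ 0 := by rintro rfl; simp at hne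
    have hs0 : s ≠ 0 := by rintro rfl; simp at hne
    have hlp := (ih hp).resolve_left hp0
    have hls := (ih hs).resolve_left hs0
    have hle1 : Module.length A (LinearMap.range ((s ∘ₗ r) ∘ₗ p)) ≤
        Module.length A (LinearMap.range s) :=
      Module.length_le_of_injective (Submodule.inclusion
        (show LinearMap.range ((s ∘ₗ r) ∘ₗ p) ≤ LinearMap.range s by
          rw [LinearMap.comp_assoc]; exact LinearMap.range_comp_le_range _ _))
        (Submodule.inclusion_injective _)
    by_contra hgt
    have hfin : Module.length A (LinearMap.range ((s ∘ₗ r) ∘ₗ p)) ≠ ⊤ := Module.length_ne_top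
    have hfinp : Module.length A (LinearMap.range p) ≠ ⊤ := Module.length_ne_top
    have hfins : Module.length A (LinearMap.range s) ≠ ⊤ := Module.length_ne_top
    -- If the bound failed to improve, the images of `p` and `s` would be no longer than that of the
    -- whole composite. Both resulting splittings then force `r` to be bijective.
    have key : Module.length A (LinearMap.range p) ≤
          Module.length A (LinearMap.range ((s ∘ₗ r) ∘ₗ p)) ∧
        Module.length A (LinearMap.range s) ≤
          Module.length A (LinearMap.range ((s ∘ₗ r) ∘ₗ p)) := by
      lift Module.length A (LinearMap.range ((s ∘ₗ r) ∘ₗ p)) to ℕ using hfin with x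
      lift Module.length A (LinearMap.range p) to ℕ using hfinp with y
      lift Module.length A (LinearMap.range s) to ℕ using hfins with z
      norm_cast at *
      omega
    have hrs : LinearMap.range s ≤ LinearMap.range ((s ∘ₗ r) ∘ₗ p) := by
      have hle : LinearMap.range ((s ∘ₗ r) ∘ₗ p) ≤ LinearMap.range s := by
        rw [LinearMap.comp_assoc]; exact LinearMap.range_comp_le_range _ _
      by_contra hcon
      have := Submodule.height_strictMono (R := A) (M := M j) (lt_of_le_not_ge hle hcon)
      rw [← Module.length_submodule, ← Module.length_submodule] at this
      exact absurd key.2 (not_le.mpr this)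
    have hc1 : IsCompl (LinearMap.range p) (LinearMap.ker (s ∘ₗ r)) :=
      isCompl_range_ker_of_range_comp_eq p (s ∘ₗ r)
        (disjoint_range_ker_of_length_le p (s ∘ₗ r) key.1)
        ((LinearMap.range_comp_le_range r s).trans hrs)
    have hinj : Function.Injective r := by
      have := ((hM k).2 _ _ hc1).resolve_left
        fun h0 => hp0 (LinearMap.range_eq_bot.mp h0)
      rw [LinearMap.ker_eq_bot] at this
      exact Function.Injective.of_comp this
    have hrp : Module.length A (LinearMap.range (r ∘ₗ p)) ≤ Module.length A (LinearMap.range p) := by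
      rw [LinearMap.range_comp]
      exact Module.length_le_of_surjective _ (LinearMap.submoduleMap_surjective r _)
    have hc2 : IsCompl (LinearMap.range (r ∘ₗ p)) (LinearMap.ker s) :=
      isCompl_range_ker_of_range_comp_eq (r ∘ₗ p) s
        (disjoint_range_ker_of_length_le (r ∘ₗ p) s (hrp.trans key.1)) hrs
    have hk : LinearMap.ker s = ⊥ := by
      refine ((hM l).2 _ _ hc2).resolve_left fun h0 => hne ?_
      rw [LinearMap.comp_assoc, LinearMap.range_eq_bot.mp h0, LinearMap.comp_zero]
    have hsurj : Function.Surjective r := by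
      have ht := hc2.sup_eq_top
      rw [hk, sup_bot_eq, LinearMap.range_eq_top] at ht
      exact Function.Surjective.of_comp ht
    exact hr ⟨hinj, hsurj⟩

theorem exists_isRadicalPath_eq_zero [Finite ι] [∀ i, IsArtinian A (M i)]
    [∀ i, IsNoetherian A (M i)] (hM : ∀ i, IsIndecomposableModule A (M i)) :
    ∃ n, ∀ i j (f : M i →ₗ[A] M j), IsRadicalPath M n i j f → f = 0 := by
  have := Fintype.ofFinite ι
  let b := Finset.univ.sup fun i => (Module.length A (M i)).toNat
  have hb : ∀ i, Module.length A (M i) ≤ b := fun i => by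
    rw [← ENat.natCast_toNat (Module.length_ne_top (R := A) (M := M i))]
    exact_mod_cast Finset.le_sup (f := fun i => (Module.length A (M i)).toNat) (Finset.mem_univ i)
  -- With `m = b` the bound leaves only length zero for the image.
  refine ⟨2 ^ b - 1, fun i j f hf => ?_⟩
  refine (hf.eq_zero_or_length_le hM hb b).elim id fun h => ?_
  have h0 : Module.length A (LinearMap.range f) = 0 := by
    have hfin : Module.length A (LinearMap.range f) ≠ ⊤ := Module.length_ne_top
    lift Module.length A (LinearMap.range f) to ℕ using hfin with x
    norm_cast at *
    omega
  rw [Module.length_eq_zero_iff, Submodule.subsingleton_iff_eq_bot] at h0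
  exact LinearMap.range_eq_bot.mp h0

end HaradaSai

/-! ### The nilpotent radical and Nakayama's lemma -/

section RadicalMul

variable {A : Type*} [Ring A] {ι : Type*} {M : ι → Type u} [∀ i, AddCommGroup (M i)]
  [∀ i, Module A (M i)] {X : Type*} [AddCommGroup X] [Module A X]

/-- The sums of maps `φ ∘ r` with `φ` in `G` and `r` a map of the family `M` that is not
bijective. -/
def radicalMul (G : ∀ i, AddSubgroup (M i →ₗ[A] X)) (i : ι) : AddSubgroup (M i →ₗ[A] X) :=
  AddSubgroup.closure {f | ∃ j, ∃ φ ∈ G j, ∃ r : M i →ₗ[A] M j, ¬ Function.Bijective r ∧ f = φ ∘ₗ r}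

theorem comp_mem_radicalMul {G : ∀ i, AddSubgroup (M i →ₗ[A] X)} {i j : ι} {φ : M j →ₗ[A] X}
    (hφ : φ ∈ G j) {r : M i →ₗ[A] M j} (hr : ¬ Function.Bijective r) :
    φ ∘ₗ r ∈ radicalMul G i :=
  AddSubgroup.subset_closure ⟨j, φ, hφ, r, hr, rfl⟩

theorem radicalMul_le_iff {G : ∀ i, AddSubgroup (M i →ₗ[A] X)} {i : ι}
    {H : AddSubgroup (M i →ₗ[A] X)} :
    radicalMul G i ≤ H ↔
      ∀ j, ∀ φ ∈ G j, ∀ r : M i →ₗ[A] M j, ¬ Function.Bijective r → φ ∘ₗ r ∈ H := by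
  refine ⟨fun h j φ hφ r hr => h (comp_mem_radicalMul hφ hr), fun h => ?_⟩
  rw [radicalMul, AddSubgroup.closure_le]
  rintro _ ⟨j, φ, hφ, r, hr, rfl⟩
  exact h j φ hφ r hr

theorem radicalMul_mono : Monotone (radicalMul (A := A) (M := M) (X := X)) := fun _ _ h _ =>
  radicalMul_le_iff.mpr fun j _ hφ _ hr => comp_mem_radicalMul (h j hφ) hr

theorem radicalMul_sup_le (G H : ∀ i, AddSubgroup (M i →ₗ[A] X)) :
    radicalMul (G ⊔ H) ≤ radicalMul G ⊔ radicalMul H := fun i => by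
  refine radicalMul_le_iff.mpr fun j φ hφ r hr => ?_
  obtain ⟨a, ha, b, hb, rfl⟩ := AddSubgroup.mem_sup.mp hφ
  rw [LinearMap.add_comp]
  exact AddSubgroup.mem_sup.mpr ⟨_, comp_mem_radicalMul ha hr, _, comp_mem_radicalMul hb hr, rfl⟩

theorem radicalMul_iterate_le (G : ∀ i, AddSubgroup (M i →ₗ[A] X)) (n : ℕ) (i : ι) :
    radicalMul^[n] G i ≤ AddSubgroup.closure
      {f | ∃ j, ∃ φ ∈ G j, ∃ r : M i →ₗ[A] M j, IsRadicalPath M n i j r ∧ f = φ ∘ₗ r} := by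
  induction n generalizing i with
  | zero => exact fun f hf => AddSubgroup.subset_closure ⟨i, f, hf, _, .id i, rfl⟩
  | succ n ih =>
    rw [Function.iterate_succ_apply']
    refine radicalMul_le_iff.mpr fun j φ hφ r hr => ?_
    have := ih j hφ
    clear hφ
    induction this using AddSubgroup.closure_induction with
    | mem f hf =>
      obtain ⟨k, ψ, hψ, s, hs, rfl⟩ := hf
      exact AddSubgroup.subset_closure ⟨k, ψ, hψ, s ∘ₗ r, .comp _ _ hr hs, rfl⟩
    | zero => rw [LinearMap.zero_comp]; exact zero_mem _
    | add f g _ _ hf hg => rw [LinearMap.add_comp]; exact add_mem hf hg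
    | neg f _ hf => rw [LinearMap.neg_comp]; exact neg_mem hf

theorem exists_radicalMul_iterate_eq_bot [Finite ι] [∀ i, IsArtinian A (M i)]
    [∀ i, IsNoetherian A (M i)] (hM : ∀ i, IsIndecomposableModule A (M i)) :
    ∃ n, ∀ G : ∀ i, AddSubgroup (M i →ₗ[A] X), radicalMul^[n] G = ⊥ := by
  obtain ⟨n, hn⟩ := exists_isRadicalPath_eq_zero hM
  refine ⟨n, fun G => eq_bot_iff.mpr fun i => (radicalMul_iterate_le G n i).trans ?_⟩
  rw [AddSubgroup.closure_le]
  rintro _ ⟨j, φ, -, r, hr, rfl⟩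
  rw [hn i j r hr, LinearMap.comp_zero]
  exact zero_mem _

/-- Nakayama for a nilpotent radical: iterating the inclusion puts `G` inside a vanishing power. -/
theorem eq_bot_of_le_radicalMul [Finite ι] [∀ i, IsArtinian A (M i)]
    [∀ i, IsNoetherian A (M i)] (hM : ∀ i, IsIndecomposableModule A (M i))
    {G : ∀ i, AddSubgroup (M i →ₗ[A] X)} (hG : G ≤ radicalMul G) : G = ⊥ := by
  obtain ⟨n, hn⟩ := exists_radicalMul_iterate_eq_bot (X := X) hM
  refine eq_bot_iff.mpr ((?_ : G ≤ radicalMul^[n] G).trans_eq (hn G))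
  clear hn
  induction n with
  | zero => exact le_rfl
  | succ n ih =>
    rw [Function.iterate_succ_apply']
    exact hG.trans (radicalMul_mono ih)

/-- The dual form of Nakayama: substitute the equation into itself until the radical term vanishes,
`H` absorbing its own radical multiples. -/
theorem eq_top_of_sup_radicalMul_eq_top [Finite ι] [∀ i, IsArtinian A (M i)]
    [∀ i, IsNoetherian A (M i)] (hM : ∀ i, IsIndecomposableModule A (M i))
    {H : ∀ i, AddSubgroup (M i →ₗ[A] X)} (hH : radicalMul H ≤ H)
    (h : H ⊔ radicalMul ⊤ = ⊤) : H = ⊤ := by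
  obtain ⟨n, hn⟩ := exists_radicalMul_iterate_eq_bot (X := X) hM
  suffices hs : ⊤ ≤ H ⊔ radicalMul^[n] ⊤ by
    rw [hn, sup_bot_eq] at hs
    exact top_le_iff.mp hs
  clear hn
  induction n with
  | zero => exact le_sup_right
  | succ n ih =>
    rw [Function.iterate_succ_apply']
    calc ⊤ = H ⊔ radicalMul ⊤ := h.symm
      _ ≤ H ⊔ radicalMul (H ⊔ radicalMul^[n] ⊤) := sup_le_sup_left (radicalMul_mono ih) _
      _ ≤ H ⊔ (radicalMul H ⊔ radicalMul (radicalMul^[n] ⊤)) :=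
        sup_le_sup_left (radicalMul_sup_le _ _) _
      _ ≤ H ⊔ radicalMul (radicalMul^[n] ⊤) :=
        sup_le le_sup_left (sup_le (hH.trans le_sup_left) le_sup_right)

end RadicalMul

/-- Every non-unit of `E` annihilates `V ⧸ W`, so for `W ≠ ⊤` the quotient of `E` by that
annihilator is a division ring; lift a basis of `V ⧸ W` over it. -/
theorem exists_basis_modulo {E : Type*} {V : Type u} [Ring E] [AddCommGroup V] [Module E V]
    (W : Submodule E V) (hW : ∀ (a : E) (v : V), ¬ IsUnit a → a • v ∈ W) :
    ∃ (κ : Type u) (b : κ → V), Submodule.span E (Set.range b) ⊔ W = ⊤ ∧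
      ∀ (s : Finset κ) (c : κ → E), ∑ k ∈ s, c k • b k ∈ W → ∀ k ∈ s, ¬ IsUnit (c k) := by
  by_cases hWt : W = ⊤
  · exact ⟨PEmpty, PEmpty.elim, by simp [hWt], fun s c _ b => b.elim⟩
  let I := Module.annihilator E (V ⧸ W)
  have hI : I ≠ ⊤ := fun h => by
    have h1 : (1 : E) ∈ I := h ▸ Submodule.mem_top
    rw [Module.mem_annihilator] at h1
    refine hWt (eq_top_iff.mpr fun x _ => ?_)
    simpa only [one_smul, Submodule.mkQ_apply, Submodule.Quotient.mk_eq_zero] using h1 (W.mkQ x)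
  have hmem : ∀ a : E, ¬ IsUnit a → a ∈ I := fun a ha => by
    rw [Module.mem_annihilator]
    intro x
    obtain ⟨v, rfl⟩ := W.mkQ_surjective x
    rw [← map_smul, Submodule.mkQ_apply, Submodule.Quotient.mk_eq_zero]
    exact hW a v ha
  have : Nontrivial (E ⧸ I) := Ideal.Quotient.nontrivial_iff.mpr hI
  let : DivisionRing (E ⧸ I) := DivisionRing.ofIsUnitOrEqZero fun a => by
    obtain ⟨a, rfl⟩ := Ideal.Quotient.mk_surjective a
    by_cases ha : IsUnit a
    · exact .inl (ha.map _)
    · exact .inr (Ideal.Quotient.eq_zero_iff_mem.mpr (hmem a ha))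
  let : Module (E ⧸ I) (V ⧸ W) := Module.quotientAnnihilator
  have hsmul (a : E) (x : V ⧸ W) : Ideal.Quotient.mk I a • x = a • x := rfl
  let β := Module.Basis.ofVectorSpace (E ⧸ I) (V ⧸ W)
  let v : Module.Basis.ofVectorSpaceIndex (E ⧸ I) (V ⧸ W) → V :=
    fun k => Function.surjInv W.mkQ_surjective (β k)
  have hv (k) : W.mkQ (v k) = β k := Function.surjInv_eq W.mkQ_surjective (β k)
  refine ⟨_, v, ?_, fun s c hs k hk hu => ?_⟩
  · refine eq_top_iff.mpr fun x _ => ?_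
    have hx : W.mkQ x ∈ Submodule.map W.mkQ (Submodule.span E (Set.range v)) := by
      have h1 : W.mkQ x ∈ Submodule.span (E ⧸ I) (Set.range β) := by
        rw [β.span_eq]; exact Submodule.mem_top
      generalize W.mkQ x = w at h1 ⊢
      induction h1 using Submodule.span_induction with
      | mem y hy =>
        obtain ⟨k, rfl⟩ := hy
        exact ⟨v k, Submodule.subset_span ⟨k, rfl⟩, hv k⟩
      | zero => exact zero_mem _
      | add y z _ _ hy hz => exact add_mem hy hz
      | smul a y _ hy =>
        obtain ⟨a, rfl⟩ := Ideal.Quotient.mk_surjective a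
        rw [hsmul]
        exact Submodule.smul_mem _ a hy
    obtain ⟨y, hy, hyx⟩ := hx
    refine Submodule.mem_sup.mpr ⟨y, hy, x - y, ?_, by abel⟩
    rw [← Submodule.Quotient.mk_eq_zero, ← Submodule.mkQ_apply, map_sub, hyx, sub_self]
  · rw [← Submodule.Quotient.mk_eq_zero, ← Submodule.mkQ_apply, map_sum] at hs
    have h0 := linearIndependent_iff'.mp β.linearIndependent s
      (fun k => Ideal.Quotient.mk I (c k)) (by
        rw [← hs]
        exact Finset.sum_congr rfl fun k _ => by rw [map_smul, hv, hsmul]) k hk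
    exact (hu.map (Ideal.Quotient.mk I)).ne_zero h0

/-! ### Finite sums of members and lifting -/

section IsFiniteSumOf

/-- A module is a finite direct sum of copies of members of the family `M`. -/
def IsFiniteSumOf (A : Type*) [Ring A] {ι : Type*} (M : ι → Type u) [∀ i, AddCommGroup (M i)]
    [∀ i, Module A (M i)] (Z : Type*) [AddCommGroup Z] [Module A Z] : Prop :=
  ∃ (T : Type) (_ : Fintype T) (t : T → ι), Nonempty (Z ≃ₗ[A] Π a, M (t a))

variable {A : Type*} [Ring A] {ι : Type*} {M : ι → Type u} [∀ i, AddCommGroup (M i)]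
  [∀ i, Module A (M i)] {X Y Z : Type*} [AddCommGroup X] [Module A X] [AddCommGroup Y] [Module A Y]
  [AddCommGroup Z] [Module A Z]

theorem LinearMap.eq_sum_comp_single_comp_proj {T : Type*} [Fintype T] [DecidableEq T]
    {P : T → Type*} [∀ a, AddCommGroup (P a)] [∀ a, Module A (P a)] (f : (Π a, P a) →ₗ[A] X) :
    f = ∑ a, (f ∘ₗ LinearMap.single A P a) ∘ₗ LinearMap.proj a := by
  refine LinearMap.pi_ext fun a x => ?_
  rw [LinearMap.sum_apply, Finset.sum_eq_single a]
  · simp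
  · intro b _ hb
    simp [Pi.single_eq_of_ne hb]
  · simp

theorem IsFiniteSumOf.exists_comp_eq (hZ : IsFiniteSumOf A M Z) (g : Y →ₗ[A] X)
    (hg : ∀ i (φ : M i →ₗ[A] X), ∃ ψ : M i →ₗ[A] Y, g ∘ₗ ψ = φ) (h : Z →ₗ[A] X) :
    ∃ h' : Z →ₗ[A] Y, g ∘ₗ h' = h := by
  classical
  obtain ⟨T, _, t, ⟨e⟩⟩ := hZ
  choose ψ hψ using fun a : T =>
    hg (t a) ((h ∘ₗ e.symm.toLinearMap) ∘ₗ LinearMap.single A (fun a => M (t a)) a)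
  refine ⟨(∑ a, ψ a ∘ₗ LinearMap.proj a) ∘ₗ e.toLinearMap, ?_⟩
  have h1 := LinearMap.eq_sum_comp_single_comp_proj (h ∘ₗ e.symm.toLinearMap)
  have h2 : g ∘ₗ (∑ a, ψ a ∘ₗ LinearMap.proj a) = h ∘ₗ e.symm.toLinearMap := by
    rw [h1]
    ext x
    simp only [LinearMap.comp_apply, LinearMap.sum_apply, map_sum]
    refine Finset.sum_congr rfl fun a _ => ?_
    exact LinearMap.congr_fun (hψ a) _
  rw [← LinearMap.comp_assoc, h2, LinearMap.comp_assoc]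
  ext x; simp

end IsFiniteSumOf

/-! ### Approximation modulo the radical -/

section Approximation

variable {A : Type*} [Ring A] {ι : Type*} {M : ι → Type u} [∀ i, AddCommGroup (M i)]
  [∀ i, Module A (M i)]

theorem exists_finset_component_eq_zero {N : Type*} [AddCommGroup N] [Module A N]
    [Module.Finite A N] {K : Type*} [DecidableEq K] {P : K → Type*} [∀ k, AddCommGroup (P k)]
    [∀ k, Module A (P k)] (f : N →ₗ[A] DirectSum K P) :
    ∃ s : Finset K, ∀ k ∉ s, DirectSum.component A K P k ∘ₗ f = 0 := by
  classical
  obtain ⟨S, hS⟩ := (Module.Finite.fg_top : (⊤ : Submodule A N).FG)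
  refine ⟨S.biUnion fun x => DFinsupp.support (f x), fun k hk => ?_⟩
  refine LinearMap.ext_on_range (v := ((↑) : S → N)) (by simpa using hS) fun x => ?_
  have : k ∉ DFinsupp.support (f x) := fun h =>
    hk (Finset.mem_biUnion.mpr ⟨x, x.2, h⟩)
  exact DFinsupp.notMem_support_iff.mp this

theorem LinearMap.eq_sum_lof_comp_component {N : Type*} [AddCommGroup N] [Module A N]
    {K : Type*} [DecidableEq K] {P : K → Type*} [∀ k, AddCommGroup (P k)]
    [∀ k, Module A (P k)] (f : N →ₗ[A] DirectSum K P) (s : Finset K)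
    (hs : ∀ k ∉ s, DirectSum.component A K P k ∘ₗ f = 0) :
    f = ∑ k ∈ s, DirectSum.lof A K P k ∘ₗ DirectSum.component A K P k ∘ₗ f := by
  ext x k
  rw [LinearMap.sum_apply, DFinsupp.finsetSum_apply]
  by_cases hk : k ∈ s
  · rw [Finset.sum_eq_single k]
    · simp only [LinearMap.comp_apply, DirectSum.lof_eq_of, DirectSum.of_eq_same]
      rfl
    · intro b _ hb
      simp [DirectSum.lof_eq_of, DirectSum.of_eq_of_ne _ _ _ hb.symm]
    · exact fun h => (h hk).elim
  · rw [Finset.sum_eq_zero]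
    · exact LinearMap.congr_fun (hs k hk) x
    · intro b hb
      have : b ≠ k := by rintro rfl; exact hk hb
      simp [DirectSum.lof_eq_of, DirectSum.of_eq_of_ne _ _ _ this.symm]

theorem comp_mem_radicalMul_top {X : Type*} [AddCommGroup X] [Module A X] {i j : ι}
    (φ : M j →ₗ[A] X) {r : M i →ₗ[A] M j} (hr : ¬ Function.Bijective r) :
    φ ∘ₗ r ∈ radicalMul (X := X) ⊤ i :=
  comp_mem_radicalMul (show φ ∈ (⊤ : ∀ i, AddSubgroup (M i →ₗ[A] X)) j from trivial) hr

theorem radicalMul_top_comp_mem (hM : ∀ i, IsIndecomposableModule A (M i)) {X : Type*}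
    [AddCommGroup X] [Module A X] {i j : ι} {φ : M j →ₗ[A] X} (hφ : φ ∈ radicalMul (X := X) ⊤ j)
    (a : M i →ₗ[A] M j) : φ ∘ₗ a ∈ radicalMul (X := X) ⊤ i := by
  have := (hM i).1
  induction hφ using AddSubgroup.closure_induction with
  | mem f hf =>
    obtain ⟨k, ψ, -, r, hr, rfl⟩ := hf
    rw [LinearMap.comp_assoc]
    exact comp_mem_radicalMul_top ψ fun h => hr ((hM j).bijective_of_bijective_comp a r h).2
  | zero => rw [LinearMap.zero_comp]; exact zero_mem _
  | add f g _ _ hf hg => rw [LinearMap.add_comp]; exact add_mem hf hg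
  | neg f _ hf => rw [LinearMap.neg_comp]; exact neg_mem hf

/-- Every module is approximated by a direct sum of members of `M`, uniquely modulo the
radical. -/
theorem exists_directSum_map_modulo_radical [∀ i, IsArtinian A (M i)]
    [∀ i, IsNoetherian A (M i)] (hM : ∀ i, IsIndecomposableModule A (M i))
    (hne : ∀ i j, Nonempty (M i ≃ₗ[A] M j) → i = j)
    (X : Type u) [AddCommGroup X] [Module A X] :
    ∃ (κ : ι → Type u) (g : (DirectSum (Σ i, κ i) fun k => M k.1) →ₗ[A] X),
      (∀ i (φ : M i →ₗ[A] X), ∃ ψ, φ - g ∘ₗ ψ ∈ radicalMul (X := X) ⊤ i) ∧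
      ∀ i (f : M i →ₗ[A] DirectSum (Σ i, κ i) fun k => M k.1),
        g ∘ₗ f ∈ radicalMul (X := X) ⊤ i → f ∈ radicalMul ⊤ i := by
  classical
  -- Endomorphisms act on Hom(`M i`, `X`) by precomposition, a right action, hence `ᵈᵐᵃ`.
  have hu (i) (a : (Module.End A (M i))ᵈᵐᵃ) (ha : ¬ IsUnit a) :
      ¬ Function.Bijective (DomMulAct.mk.symm a : Module.End A (M i)) := fun h =>
    ha (((Module.End.isUnit_iff _).mpr h).op)
  let W : ∀ i, Submodule (Module.End A (M i))ᵈᵐᵃ (M i →ₗ[A] X) := fun i =>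
    { radicalMul (X := X) ⊤ i with
      smul_mem' := fun a φ hφ => by
        have := (hM i).1
        exact radicalMul_top_comp_mem hM hφ (DomMulAct.mk.symm a) }
  have hmem (i) (φ : M i →ₗ[A] X) : φ ∈ W i ↔ φ ∈ radicalMul (X := X) ⊤ i := Iff.rfl
  choose κ b hspan hind using fun i => exists_basis_modulo (W i) fun a φ ha =>
    comp_mem_radicalMul_top φ (hu i a ha)
  let g : (DirectSum (Σ i, κ i) fun k => M k.1) →ₗ[A] X :=
    DirectSum.toModule A _ X fun k => b k.1 k.2
  refine ⟨κ, g, fun i φ => ?_, fun i f hf => ?_⟩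
  · let H : Submodule (Module.End A (M i))ᵈᵐᵃ (M i →ₗ[A] X) :=
      { carrier := {φ | ∃ ψ, φ = g ∘ₗ ψ}
        zero_mem' := ⟨0, by simp⟩
        add_mem' := by
          rintro _ _ ⟨a, rfl⟩ ⟨b, rfl⟩
          exact ⟨a + b, by rw [LinearMap.comp_add]⟩
        smul_mem' := by
          rintro a _ ⟨b, rfl⟩
          exact ⟨b ∘ₗ DomMulAct.mk.symm a, rfl⟩ }
    have hH : Submodule.span (Module.End A (M i))ᵈᵐᵃ (Set.range (b i)) ≤ H := by
      rw [Submodule.span_le]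
      rintro _ ⟨k, rfl⟩
      refine ⟨DirectSum.lof A _ (fun k : Σ i, κ i => M k.1) ⟨i, k⟩, ?_⟩
      ext x
      simp [g]
    have : φ ∈ H ⊔ W i := sup_le_sup_right hH _ (by rw [hspan]; trivial)
    obtain ⟨_, ⟨ψ, rfl⟩, w, hw, rfl⟩ := Submodule.mem_sup.mp this
    exact ⟨ψ, by rwa [add_sub_cancel_left]⟩
  · obtain ⟨s, hs⟩ := exists_finset_component_eq_zero f
    rw [LinearMap.eq_sum_lof_comp_component f s hs]
    -- A bijective component would be a unit coefficient in a relation among the `b i` modulo `W i`.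
    -- Components into the other summands `M j` cannot be bijective and contribute only radical
    -- terms.
    refine sum_mem fun k hk => comp_mem_radicalMul_top _ fun hbij => ?_
    obtain ⟨i', k⟩ := k
    obtain rfl := hne _ _ ⟨LinearEquiv.ofBijective _ hbij⟩
    have hsum : ∑ k ∈ s, b k.1 k.2 ∘ₗ DirectSum.component A _ _ k ∘ₗ f ∈ W i := by
      rw [LinearMap.eq_sum_lof_comp_component f s hs] at hf
      convert (hmem _ _).mpr hf using 1
      ext x
      simp [g]
    have hinj : Set.InjOn (Sigma.mk i) (Sigma.mk i ⁻¹' (s : Set (Σ i, κ i))) :=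
      sigma_mk_injective.injOn
    refine hind i (s.preimage (Sigma.mk i) hinj)
      (fun k : κ i => DomMulAct.mk
        (DirectSum.component A (Σ i, κ i) (fun k => M k.1) ⟨i, k⟩ ∘ₗ f : M i →ₗ[A] M i)) ?_ k
      (by simpa using hk) ((Module.End.isUnit_iff _).mpr hbij).op
    rw [← Submodule.Quotient.mk_eq_zero, ← Submodule.mkQ_apply, map_sum] at hsum ⊢
    rw [← hsum]
    refine Finset.sum_preimage (Sigma.mk i) s hinj
      (fun k => (W i).mkQ (b k.1 k.2 ∘ₗ DirectSum.component A _ _ k ∘ₗ f)) fun k _ hk => ?_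
    rw [Submodule.mkQ_apply, Submodule.Quotient.mk_eq_zero]
    refine comp_mem_radicalMul_top _ fun hb => hk ?_
    obtain ⟨j, k⟩ := k
    obtain rfl := hne _ _ ⟨LinearEquiv.ofBijective _ hb⟩
    exact ⟨k, rfl⟩

end Approximation

/-! ### The decomposition theorem -/

section Decomposition

variable {A : Type*} [Ring A] {ι : Type*} {M : ι → Type u} [∀ i, AddCommGroup (M i)]
  [∀ i, Module A (M i)]

theorem exists_fintype_sum_of_mem_radicalMul {X : Type*} [AddCommGroup X] [Module A X]
    {G : ∀ i, AddSubgroup (M i →ₗ[A] X)} {i : ι} {f : M i →ₗ[A] X} (hf : f ∈ radicalMul G i) :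
    ∃ (T : Type) (_ : Fintype T) (t : T → ι) (φ : ∀ a, M (t a) →ₗ[A] X)
      (r : ∀ a, M i →ₗ[A] M (t a)), (∀ a, φ a ∈ G (t a)) ∧ (∀ a, ¬ Function.Bijective (r a)) ∧
        f = ∑ a, φ a ∘ₗ r a := by
  induction hf using AddSubgroup.closure_induction with
  | mem f hf =>
    obtain ⟨j, φ, hφ, r, hr, rfl⟩ := hf
    exact ⟨Unit, inferInstance, fun _ => j, fun _ => φ, fun _ => r, fun _ => hφ, fun _ => hr,
      by simp⟩
  | zero => exact ⟨Empty, inferInstance, Empty.elim, fun a => a.elim, fun a => a.elim,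
      fun a => a.elim, fun a => a.elim, by simp⟩
  | add f g _ _ hf hg =>
    obtain ⟨T, _, t, φ, r, hφ, hr, rfl⟩ := hf
    obtain ⟨T', _, t', φ', r', hφ', hr', rfl⟩ := hg
    refine ⟨T ⊕ T', inferInstance, Sum.elim t t', Sum.rec φ φ', Sum.rec r r',
      Sum.rec hφ hφ', Sum.rec hr hr', ?_⟩
    rw [Fintype.sum_sum_type]
    rfl
  | neg f _ hf =>
    obtain ⟨T, _, t, φ, r, hφ, hr, rfl⟩ := hf
    refine ⟨T, inferInstance, t, fun a => -φ a, r, fun a => neg_mem (hφ a), hr, ?_⟩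
    simp [LinearMap.neg_comp]

/-- If `A` and all finitely generated submodules of `X` are finite sums of members of a finite
family of indecomposable modules of finite length, then `X` is a direct sum of members of the
family. -/
theorem exists_linearEquiv_directSum [Finite ι] [∀ i, IsArtinian A (M i)]
    [∀ i, IsNoetherian A (M i)] (hM : ∀ i, IsIndecomposableModule A (M i))
    (hne : ∀ i j, Nonempty (M i ≃ₗ[A] M j) → i = j) (hA : IsFiniteSumOf A M A)
    (X : Type u) [AddCommGroup X] [Module A X]
    (hX : ∀ Z : Submodule A X, Z.FG → IsFiniteSumOf A M Z) :
    ∃ κ : ι → Type u, Nonempty ((DirectSum (Σ i, κ i) fun k => M k.1) ≃ₗ[A] X) := by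
  classical
  obtain ⟨κ, g, hgen, hind⟩ := exists_directSum_map_modulo_radical hM hne X
  refine ⟨κ, ⟨LinearEquiv.ofBijective g ?_⟩⟩
  have hlift : ∀ i (φ : M i →ₗ[A] X), ∃ ψ, g ∘ₗ ψ = φ := by
    let H : ∀ i, AddSubgroup (M i →ₗ[A] X) := fun i =>
      { carrier := {φ | ∃ ψ, g ∘ₗ ψ = φ}
        zero_mem' := ⟨0, by simp⟩
        add_mem' := by
          rintro _ _ ⟨a, rfl⟩ ⟨b, rfl⟩
          exact ⟨a + b, by rw [LinearMap.comp_add]⟩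
        neg_mem' := by
          rintro _ ⟨a, rfl⟩
          exact ⟨-a, by rw [LinearMap.comp_neg]⟩ }
    have hH : H = ⊤ := by
      refine eq_top_of_sup_radicalMul_eq_top hM (fun i => radicalMul_le_iff.mpr ?_) ?_
      · rintro j _ ⟨ψ, rfl⟩ r -
        exact ⟨ψ ∘ₗ r, rfl⟩
      · refine eq_top_iff.mpr fun i φ _ => ?_
        obtain ⟨ψ, hψ⟩ := hgen i φ
        exact AddSubgroup.mem_sup.mpr ⟨g ∘ₗ ψ, ⟨ψ, rfl⟩, _, hψ, by abel⟩
    intro i φ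
    have : φ ∈ H i := by rw [hH]; trivial
    exact this
  have hker : ∀ i (f : M i →ₗ[A] DirectSum (Σ i, κ i) fun k => M k.1), g ∘ₗ f = 0 → f = 0 := by
    let G : ∀ i, AddSubgroup (M i →ₗ[A] DirectSum (Σ i, κ i) fun k => M k.1) := fun i =>
      { carrier := {f | g ∘ₗ f = 0}
        zero_mem' := by simp
        add_mem' := by
          intro a b ha hb
          rw [Set.mem_ofPred_eq] at *
          rw [LinearMap.comp_add, ha, hb, add_zero]
        neg_mem' := by
          intro a ha
          rw [Set.mem_ofPred_eq] at *
          rw [LinearMap.comp_neg, ha, neg_zero] }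
    have hG : G = ⊥ := by
      refine eq_bot_of_le_radicalMul hM fun i f (hf : g ∘ₗ f = 0) => ?_
      have hfr : f ∈ radicalMul ⊤ i := hind i f (by rw [hf]; exact zero_mem _)
      obtain ⟨T, _, t, φ, r, -, hr, rfl⟩ := exists_fintype_sum_of_mem_radicalMul hfr
      -- Bundling the `φ a` into one map makes the image of `g ∘ₗ y` a finitely generated submodule
      -- of `X`, to which `hX` applies.
      let y : (Π a, M (t a)) →ₗ[A] DirectSum (Σ i, κ i) fun k => M k.1 :=
        ∑ a, φ a ∘ₗ LinearMap.proj a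
      have hy (a) : y ∘ₗ LinearMap.single A (fun a => M (t a)) a = φ a := by
        ext x
        simp only [y, LinearMap.comp_apply, LinearMap.sum_apply]
        rw [Finset.sum_eq_single a]
        · simp
        · intro b _ hb
          simp [Pi.single_eq_of_ne hb]
        · simp
      have hyr : y ∘ₗ LinearMap.pi r = ∑ a, φ a ∘ₗ r a := by
        ext x
        simp [y]
      have hZ := hX (LinearMap.range (g ∘ₗ y)) (by
        rw [LinearMap.range_eq_map]
        exact Submodule.FG.map _ Module.Finite.fg_top)
      obtain ⟨h', hh'⟩ := hZ.exists_comp_eq g hlift (LinearMap.range (g ∘ₗ y)).subtype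
      -- The correction kills `g ∘ₗ y`, yet vanishes after `LinearMap.pi r` because `g ∘ₗ f = 0`.
      let y' := y - h' ∘ₗ (g ∘ₗ y).rangeRestrict
      have hy' : g ∘ₗ y' = 0 := by
        simp only [y', LinearMap.comp_sub]
        rw [← LinearMap.comp_assoc, hh', LinearMap.subtype_comp_codRestrict, sub_self]
      have hq : (g ∘ₗ y).rangeRestrict ∘ₗ LinearMap.pi r = 0 := by
        ext x
        rw [← hyr] at hf
        exact LinearMap.congr_fun hf x
      have hy'r : y' ∘ₗ LinearMap.pi r = ∑ a, φ a ∘ₗ r a := by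
        rw [← hyr]
        simp only [y', LinearMap.sub_comp]
        rw [LinearMap.comp_assoc, hq, LinearMap.comp_zero, sub_zero]
      have hsum : y' ∘ₗ LinearMap.pi r =
          ∑ a, (y' ∘ₗ LinearMap.single A (fun a => M (t a)) a) ∘ₗ r a := by
        nth_rw 1 [LinearMap.eq_sum_comp_single_comp_proj y']
        ext x
        simp only [LinearMap.comp_apply, LinearMap.sum_apply, LinearMap.proj_apply,
          LinearMap.pi_apply]
      rw [← hy'r, hsum]
      refine sum_mem fun a _ => ?_
      refine comp_mem_radicalMul ?_ (hr a)
      change g ∘ₗ y' ∘ₗ _ = 0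
      rw [← LinearMap.comp_assoc, hy', LinearMap.zero_comp]
    intro i f hf
    have : f ∈ G i := hf
    rwa [hG] at this
  -- Elements are maps from the regular module, a finite sum of members, so `hker` and `hlift` pass
  -- to elements.
  constructor
  · rw [injective_iff_map_eq_zero]
    intro y hy
    obtain ⟨T, _, t, ⟨e⟩⟩ := hA
    let f := LinearMap.toSpanSingleton A _ y ∘ₗ e.symm.toLinearMap
    have hf : f = 0 := by
      rw [LinearMap.eq_sum_comp_single_comp_proj f]
      refine Finset.sum_eq_zero fun a _ => ?_
      rw [hker _ (f ∘ₗ LinearMap.single A (fun a => M (t a)) a), LinearMap.zero_comp]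
      ext x
      simp [f, hy]
    simpa [f] using LinearMap.congr_fun hf (e 1)
  · intro x
    obtain ⟨h', hh'⟩ := hA.exists_comp_eq g hlift (LinearMap.toSpanSingleton A _ x)
    exact ⟨h' 1, by simpa using LinearMap.congr_fun hh' 1⟩

theorem IsFiniteSumOf.of_linearEquiv {Z Z' : Type*} [AddCommGroup Z] [Module A Z]
    [AddCommGroup Z'] [Module A Z'] (h : IsFiniteSumOf A M Z) (e : Z' ≃ₗ[A] Z) :
    IsFiniteSumOf A M Z' := by
  obtain ⟨T, hT, t, ⟨e'⟩⟩ := h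
  exact ⟨T, hT, t, ⟨e.trans e'⟩⟩

theorem IsFiniteSumOf.prod {Z Z' : Type*} [AddCommGroup Z] [Module A Z]
    [AddCommGroup Z'] [Module A Z'] (h : IsFiniteSumOf A M Z) (h' : IsFiniteSumOf A M Z') :
    IsFiniteSumOf A M (Z × Z') := by
  obtain ⟨T, hT, t, ⟨e⟩⟩ := h
  obtain ⟨T', hT', t', ⟨e'⟩⟩ := h'
  exact ⟨T ⊕ T', inferInstance, Sum.elim t t',
    ⟨(e.prodCongr e').trans
      (LinearEquiv.sumPiEquivProdPi A T T' (fun a => M (Sum.elim t t' a))).symm⟩⟩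

/-- Descending chain induction: both summands in a nontrivial splitting are strictly smaller.
Staying inside one ambient `Z` makes `<` the induction order. -/
theorem isFiniteSumOf_of_forall_submodule {Z : Type*} [AddCommGroup Z] [Module A Z]
    [IsArtinian A Z] (h : ∀ p : Submodule A Z, IsIndecomposableModule A p →
      ∃ i, Nonempty (p ≃ₗ[A] M i)) (p : Submodule A Z) : IsFiniteSumOf A M p := by
  induction p using WellFoundedLT.induction with
  | ind p ih =>
  rcases subsingleton_or_nontrivial p with hs | hn
  · exact ⟨Empty, inferInstance, Empty.elim, ⟨0, 0, fun x => Subsingleton.elim _ _,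
      fun x => Subsingleton.elim _ _⟩⟩
  by_cases hp : IsIndecomposableModule A p
  · obtain ⟨i, ⟨e⟩⟩ := h p hp
    exact ⟨Unit, inferInstance, fun _ => i,
      ⟨e.trans (LinearEquiv.funUnique Unit A (M i)).symm⟩⟩
  · simp only [IsIndecomposableModule, hn, true_and] at hp
    push Not at hp
    obtain ⟨a, b, hab, ha, hb⟩ := hp
    have hlt {a b : Submodule A p} (hab : IsCompl a b) (hb : b ≠ ⊥) : a.map p.subtype < p := by
      have hat : a ≠ ⊤ := by
        rintro rfl
        exact hb (by simpa using hab.inf_eq_bot)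
      have := Submodule.map_strictMono_of_injective p.injective_subtype (lt_top_iff_ne_top.mpr hat)
      simpa using this
    have hfs {a b : Submodule A p} (hab : IsCompl a b) (hb : b ≠ ⊥) : IsFiniteSumOf A M a :=
      (ih _ (hlt hab hb)).of_linearEquiv (Submodule.equivSubtypeMap p a)
    exact ((hfs hab hb).prod (hfs hab.symm ha)).of_linearEquiv
      (Submodule.prodEquivOfIsCompl a b hab).symm

end Decomposition

/-! ### Internal sums, representatives and the theorem -/

theorem isInternal_range_comp_lof {A : Type*} [Ring A] {K : Type*} [DecidableEq K] {P : K → Type*}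
    [∀ k, AddCommGroup (P k)] [∀ k, Module A (P k)] {X : Type*} [AddCommGroup X] [Module A X]
    (e : DirectSum K P ≃ₗ[A] X) :
    DirectSum.IsInternal fun k => LinearMap.range (e.toLinearMap ∘ₗ DirectSum.lof A K P k) := by
  have hinj (k) : Function.Injective (e.toLinearMap ∘ₗ DirectSum.lof A K P k) :=
    e.injective.comp (DirectSum.of_injective k)
  let E : DirectSum K P ≃ₗ[A] DirectSum K
      fun k => LinearMap.range (e.toLinearMap ∘ₗ DirectSum.lof A K P k) :=
    DFinsupp.mapRange.linearEquiv fun k => LinearEquiv.ofInjective _ (hinj k)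
  have hE : DirectSum.coeLinearMap (fun k =>
      LinearMap.range (e.toLinearMap ∘ₗ DirectSum.lof A K P k)) ∘ₗ E.toLinearMap =
        e.toLinearMap := by
    refine DirectSum.linearMap_ext _ fun k => ?_
    ext x
    have : E (DirectSum.lof A K P k x) =
        DirectSum.lof A K _ k (LinearEquiv.ofInjective _ (hinj k) x) :=
      DFinsupp.mapRange_single (hf := fun i => map_zero _)
    simp only [LinearMap.comp_apply, LinearEquiv.coe_coe, this, DirectSum.coeLinearMap_lof]
    rfl
  have hb : Function.Bijective (DirectSum.coeLinearMap (fun k =>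
      LinearMap.range (e.toLinearMap ∘ₗ DirectSum.lof A K P k)) ∘ E) := by
    have : ⇑(DirectSum.coeLinearMap (fun k =>
      LinearMap.range (e.toLinearMap ∘ₗ DirectSum.lof A K P k))) ∘ E = e := congrArg DFunLike.coe hE
    rw [this]
    exact e.bijective
  exact (Function.Bijective.of_comp_iff _ E.bijective).mp hb

/-- The ring `R` is isomorphic to `Rᵐᵒᵖ` as a right `R`-module. -/
def opLinearEquivMulOpposite (R : Type*) [Ring R] : R ≃ₗ[Rᵐᵒᵖ] Rᵐᵒᵖ :=
  { MulOpposite.opAddEquiv with map_smul' := fun _ _ => rfl }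

theorem isFiniteLength_of_finite {A M : Type*} [Ring A] [IsArtinianRing A] [AddCommGroup M]
    [Module A M] [Module.Finite A M] : IsFiniteLength A M :=
  isFiniteLength_iff_isNoetherian_isArtinian.mpr ⟨inferInstance, inferInstance⟩

/-- A finite list of finite-length indecomposables can be replaced by a list of pairwise
non-isomorphic ones. -/
theorem exists_finite_family_representatives {A : Type u} [Ring A] {n : ℕ}
    (M : Fin n → ModuleCat.{u} A) :
    ∃ (ι : Type) (_ : Finite ι) (M' : ι → ModuleCat.{u} A),
      (∀ i, IsFiniteLength A (M' i)) ∧ (∀ i, IsIndecomposableModule A (M' i)) ∧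
      (∀ i j, Nonempty (M' i ≃ₗ[A] M' j) → i = j) ∧
      ∀ i, IsFiniteLength A (M i) → IsIndecomposableModule A (M i) →
        ∃ j, Nonempty (M i ≃ₗ[A] M' j) := by
  let ι₀ := {i : Fin n // IsFiniteLength A (M i) ∧ IsIndecomposableModule A (M i)}
  let r : Setoid ι₀ :=
    { r := fun i j => Nonempty (M i.1 ≃ₗ[A] M j.1)
      iseqv := ⟨fun i => ⟨LinearEquiv.refl A _⟩, fun ⟨e⟩ => ⟨e.symm⟩,
        fun ⟨e⟩ ⟨e'⟩ => ⟨e.trans e'⟩⟩ }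
  refine ⟨Quotient r, inferInstance, fun q => M q.out.1, fun q => q.out.2.1, fun q => q.out.2.2,
    fun p q hpq => ?_, fun i hi hi' => ⟨Quotient.mk r ⟨i, hi, hi'⟩, ?_⟩⟩
  · rw [← Quotient.out_eq p, ← Quotient.out_eq q]
    exact Quotient.sound hpq
  · exact r.symm (Quotient.mk_out (s := r) ⟨i, hi, hi'⟩)

theorem IsIndecomposableModule.exists_eq_top_of_isInternal {A X I : Type*} [Ring A]
    [AddCommGroup X] [Module A X] [DecidableEq I] (hX : IsIndecomposableModule A X)
    {N : I → Submodule A X} (hN : DirectSum.IsInternal N) (h : ∀ i, N i ≠ ⊥) :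
    ∃ i, N i = ⊤ := by
  have hI : Nonempty I := by
    by_contra hI
    rw [not_nonempty_iff] at hI
    have := hN.submodule_iSup_eq_top
    rw [iSup_of_empty] at this
    have h1 := hX.1
    exact bot_ne_top this
  obtain ⟨i⟩ := hI
  have hc : IsCompl (N i) (⨆ (j) (_ : j ≠ i), N j) :=
    ⟨hN.submodule_iSupIndep i, codisjoint_iff_le_sup.mpr (by
      rw [← hN.submodule_iSup_eq_top]
      refine iSup_le fun j => ?_
      by_cases hj : j = i
      · exact hj ▸ le_sup_left
      · exact (le_iSup₂_of_le (f := fun j (_ : j ≠ i) => N j) j hj le_rfl).trans le_sup_right)⟩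
  refine ⟨i, ?_⟩
  have := (hX.2 _ _ hc).resolve_left (h i)
  simpa [this] using hc.sup_eq_top

theorem theorem1 {R : Type u} [Ring R] [IsArtinianRing Rᵐᵒᵖ]
    (S : ObjectProperty (ModuleCat.{u} Rᵐᵒᵖ))
    (hR : S (ModuleCat.of Rᵐᵒᵖ R))
    (hsum : ∀ (J : Type u) (Y : J → ModuleCat.{u} Rᵐᵒᵖ), (∀ j, S (Y j)) →
      S (ModuleCat.of Rᵐᵒᵖ (DirectSum J fun j => Y j)))
    (hsub : S.IsClosedUnderSubobjects)
    (hfin : ∃ (n : ℕ) (M : Fin n → ModuleCat.{u} Rᵐᵒᵖ),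
      ∀ X : ModuleCat.{u} Rᵐᵒᵖ, S X → IsFiniteLength Rᵐᵒᵖ X → Indecomposable X →
        ∃ i, Nonempty (X ≅ M i)) :
    (∀ X : ModuleCat.{u} Rᵐᵒᵖ, S X →
      ∃ (I : Type u) (_ : DecidableEq I) (N : I → Submodule Rᵐᵒᵖ X),
        DirectSum.IsInternal N ∧
          ∀ i, (N i).FG ∧ Indecomposable (ModuleCat.of Rᵐᵒᵖ (N i))) ∧
    (∀ X : ModuleCat.{u} Rᵐᵒᵖ, S X → Indecomposable X → IsFiniteLength Rᵐᵒᵖ X) := by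
  classical
  have hmono {X : ModuleCat.{u} Rᵐᵒᵖ} (hX : S X) {Z : Type u} [AddCommGroup Z] [Module Rᵐᵒᵖ Z]
      (f : Z →ₗ[Rᵐᵒᵖ] X) (hf : Function.Injective f) : S (ModuleCat.of Rᵐᵒᵖ Z) :=
    have : Mono (ModuleCat.ofHom f) := (ModuleCat.mono_iff_injective _).mpr hf
    hsub.prop_of_mono (ModuleCat.ofHom f) hX
  obtain ⟨n, M₀, hM₀⟩ := hfin
  obtain ⟨ι, _, M, hfl, hM, hne, hrep⟩ := exists_finite_family_representatives M₀
  have hart (i) : IsArtinian Rᵐᵒᵖ (M i) :=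
    (isFiniteLength_iff_isNoetherian_isArtinian.mp (hfl i)).2
  have hnoeth (i) : IsNoetherian Rᵐᵒᵖ (M i) :=
    (isFiniteLength_iff_isNoetherian_isArtinian.mp (hfl i)).1
  -- Over an artinian ring `Z` has finite length, so its indecomposable submodules have finite
  -- length and lie in `S`, hence occur in the family.
  have hfg {X : ModuleCat.{u} Rᵐᵒᵖ} (hX : S X) (Z : Submodule Rᵐᵒᵖ X) (hZ : Z.FG) :
      IsFiniteSumOf Rᵐᵒᵖ (fun i => M i) Z := by
    have : Module.Finite Rᵐᵒᵖ Z := .of_fg hZ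
    refine (isFiniteSumOf_of_forall_submodule (fun p hp => ?_) ⊤).of_linearEquiv
      Submodule.topEquiv.symm
    have hSp := hmono hX (Z.subtype ∘ₗ p.subtype)
      (Z.injective_subtype.comp p.injective_subtype)
    have hpf : IsFiniteLength Rᵐᵒᵖ p := isFiniteLength_of_finite
    obtain ⟨i, ⟨e⟩⟩ := hM₀ (ModuleCat.of Rᵐᵒᵖ p) hSp hpf
      ((indecomposable_iff_isIndecomposableModule _).mpr hp)
    obtain ⟨j, ⟨e'⟩⟩ := hrep i (e.toLinearEquiv.isFiniteLength hpf)
      (e.toLinearEquiv.isIndecomposableModule hp)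
    exact ⟨j, ⟨e.toLinearEquiv.trans e'⟩⟩
  have hA : IsFiniteSumOf Rᵐᵒᵖ (fun i => M i) Rᵐᵒᵖ := by
    have : Module.Finite Rᵐᵒᵖ R := .equiv (opLinearEquivMulOpposite R).symm
    exact (hfg hR ⊤ Module.Finite.fg_top).of_linearEquiv
      ((opLinearEquivMulOpposite R).symm.trans Submodule.topEquiv.symm)
  have main (X : ModuleCat.{u} Rᵐᵒᵖ) (hX : S X) :
      ∃ (I : Type u) (_ : DecidableEq I) (N : I → Submodule Rᵐᵒᵖ X),
        DirectSum.IsInternal N ∧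
          ∀ i, (N i).FG ∧ Indecomposable (ModuleCat.of Rᵐᵒᵖ (N i)) := by
    obtain ⟨κ, ⟨e⟩⟩ := exists_linearEquiv_directSum hM hne hA X (hfg hX)
    refine ⟨_, inferInstance, _, isInternal_range_comp_lof e, fun k => ⟨?_, ?_⟩⟩
    · rw [LinearMap.range_eq_map]
      exact Submodule.FG.map _ Module.Finite.fg_top
    · refine (indecomposable_iff_isIndecomposableModule _).mpr
        ((LinearEquiv.ofInjective _ ?_).isIndecomposableModule (hM k.1))
      exact e.injective.comp (DirectSum.of_injective k)
  refine ⟨main, fun X hX hXi => ?_⟩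
  -- An indecomposable `X` equals one of its finitely generated summands.
  obtain ⟨I, _, N, hN, hNi⟩ := main X hX
  obtain ⟨i, hi⟩ := ((indecomposable_iff_isIndecomposableModule X).mp
    hXi).exists_eq_top_of_isInternal hN fun i => by
      have := ((indecomposable_iff_isIndecomposableModule _).mp (hNi i).2).1
      exact Submodule.nontrivial_iff_ne_bot.mp this
  have : Module.Finite Rᵐᵒᵖ X := ⟨hi ▸ (hNi i).1⟩
  exact isFiniteLength_of_finite
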